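/- Let $E$ be a hypergeometric equation, i.e. a Fuchsian equation $u''+f(x)u'+g(x)u=0$ on $\mathbb P^1(\mathbb C)$ with no singular points outside $0,1,\infty$. Let $p_0,p_1,p_\infty\in\{1,2,3,\dots\}\cup\{\infty\}$ be the orders in $\mathrm{PGL}_2(\mathbb C)$ of its local monodromies around $0,1,\infty$. Assume that $p_0\le p_1\le p_\infty$ and that $E$ is hyperbolic, that is $\frac1{p_0}+\frac1{p_1}+\frac1{p_\infty}<1$ (with $\frac1\infty=0$). Let $\phi:\mathbb P^1\to\mathbb P^1$ be a branched covering (a rational function) of degree $d$ which has at least two distinct critical values in $\mathbb P^1\setminus\{0,1,\infty\}$. Assume that the pull-back $\phi^*E$ has exactly $5$ non-apparent singularities, i.e. exactly $5$ points around which its local monodromy is nontrivial in $\mathrm{PGL}_2(\mathbb C)$. Then: 1. $d-\lfloor \frac d{p_0}\rfloor-\lfloor \frac d{p_1}\rfloor-\lfloor \frac d{p_\infty}\rfloor=1$. 2. If $p_0\le d<p_1$, then $\frac1{p_0}+\frac1d\ge1$. 3. If $p_1\le d<p_\infty$, then $\frac1{p_0}+\frac1{p_1}+\frac1d\ge1$.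 4. If $p_\infty\le d$, then $\frac45\le\frac1{p_0}+\frac1{p_1}<1$. -/

import Mathlib

open Filter Polynomial

noncomputable section

/-- A linear differential equation `u'' + p u' + q u = 0` of order two in one complex variable.
The values of `p` and `q` at their singular points are irrelevant everywhere below. -/
structure LinODE where
  p : ℂ → ℂ
  q : ℂ → ℂ

namespace LinODE

/-- `u` is a holomorphic solution on the open set `U`. -/
def IsSolutionOn (E : LinODE) (U : Set ℂ) (u : ℂ → ℂ) : Prop :=
  DifferentiableOn ℂ u U ∧
    ∀ w ∈ U, deriv (deriv u) w + E.p w * deriv u w + E.q w * u w = 0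

/-- The pull-back of the equation under `x = φ(t)`: the equation in the variable `t`
whose solutions are the functions `u ∘ φ`, with `u` a (local) solution of `E`. -/
def pullback (E : LinODE) (φ : ℂ → ℂ) : LinODE where
  p := fun t => E.p (φ t) * deriv φ t - deriv (deriv φ) t / deriv φ t
  q := fun t => E.q (φ t) * deriv φ t ^ 2

/-- The `n`-th power of the local monodromy of `E` around `a` is projectively trivial.
The map `w ↦ a + exp w` is the universal covering of a small punctured disc around `a` by the
half-plane `Re w < ρ`; the solutions of the equation pulled back to it are the multivalued
solutions of `E` near `a`, and continuation once around `a` is the translation by `2πi`.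
The condition says that its `n`-th power acts on the solutions as a nonzero scalar. -/
def ProjTrivialPow (E : LinODE) (a : ℂ) (n : ℕ) : Prop :=
  ∀ᶠ ρ : ℝ in atBot, ∃ c : ℂ, c ≠ 0 ∧
    ∀ u : ℂ → ℂ, (E.pullback fun w => a + Complex.exp w).IsSolutionOn {w | w.re < ρ} u →
      ∀ w : ℂ, w.re < ρ → u (w + n * (2 * Real.pi * Complex.I)) = c * u w

/-- The order (in `PGL₂`, possibly infinite) of the local monodromy of `E` around `a`. -/
def localOrder (E : LinODE) (a : ℂ) : ℕ∞ :=
  ⨅ n ∈ {n : ℕ | 0 < n ∧ E.ProjTrivialPow a n}, (n : ℕ∞)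

/-- The order of the local projective monodromy at a point of the projective line; at `∞` the
local coordinate `s = 1 / t` is used. -/
def orderAt (E : LinODE) : OnePoint ℂ → ℕ∞
  | .infty => (E.pullback fun s => s⁻¹).localOrder 0
  | .some a => E.localOrder a

/-- The points with nontrivial local projective monodromy, i.e. the singular points that are not
apparent (regular points and apparent singularities have order one). -/
def nonApparent (E : LinODE) : Set (OnePoint ℂ) :=
  {t | E.orderAt t ≠ 1}

/-- The Fuchsian equations of order two on the projective line with no singularities outside
`0`, `1`, `∞` (Riemann's form of the hypergeometric equation). -/
def IsHypergeometric (E : LinODE) : Prop :=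
  ∃ α₀ α₁ β₀ β₁ γ : ℂ,
    (E.p = fun x => α₀ / x + α₁ / (x - 1)) ∧
    (E.q = fun x => β₀ / x ^ 2 + β₁ / (x - 1) ^ 2 + γ / (x * (x - 1)))

end LinODE

namespace RatMap

/-- The degree of a rational function as a branched covering of the projective line. -/
def degree (φ : RatFunc ℂ) : ℕ := max φ.num.natDegree φ.denom.natDegree

/-- The rational function as a function of the affine coordinate. -/
def affine (φ : RatFunc ℂ) (t : ℂ) : ℂ := φ.num.eval t / φ.denom.eval t

open Classical in
/-- The self-map of the projective line defined by a rational function. -/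
def map (φ : RatFunc ℂ) : OnePoint ℂ → OnePoint ℂ
  | .infty =>
      if φ.denom.natDegree < φ.num.natDegree then OnePoint.infty
      else ((φ.num.coeff φ.denom.natDegree / φ.denom.leadingCoeff : ℂ) : OnePoint ℂ)
  | .some t => if φ.denom.eval t = 0 then OnePoint.infty else ((affine φ t : ℂ) : OnePoint ℂ)

/-- The polynomial whose zeros are the finite points of the fibre over `c`. -/
def fibrePoly (φ : RatFunc ℂ) : OnePoint ℂ → ℂ[X]
  | .infty => φ.denom
  | .some c => φ.num - C c * φ.denom

/-- The ramification index at a point: the multiplicity of the point in its fibre, which is a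
divisor of degree `degree φ`. -/
def ramIdx (φ : RatFunc ℂ) : OnePoint ℂ → ℕ
  | .infty => degree φ - (fibrePoly φ (map φ OnePoint.infty)).natDegree
  | .some t => (fibrePoly φ (map φ (t : OnePoint ℂ))).rootMultiplicity t

/-- The covering is ramified above `c`. -/
def IsCriticalValue (φ : RatFunc ℂ) (c : OnePoint ℂ) : Prop :=
  ∃ t, map φ t = c ∧ 2 ≤ ramIdx φ t

end RatMap

/-- `1 / p`, with `1 / ∞ = 0`. -/
def recip : ℕ∞ → ℝ
  | ⊤ => 0
  | (n : ℕ) => 1 / (n : ℝ)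

end

/-! Count the points above `0`, `1`, `∞` in two ways. If the pull-back has trivial local monodromy
at `t`, then the order of the monodromy of `E` at `φ(t)` divides the ramification index at `t`
(`toNat_orderAt_dvd_ramIdx`). So the points above `0`, `1`, `∞` whose index is not a multiple of the
order are among the five non-apparent ones (`card_badFibre_le`), while at most `⌊d/p⌋` points of a
fibre have index divisible by `p`. The three fibres thus have at most `⌊d/p₀⌋ + ⌊d/p₁⌋ + ⌊d/p∞⌋ + 5`
points. Riemann–Hurwitz with two further critical values gives at least `d + 4`
(`degree_add_four_le`), and hyperbolicity makes the sum of the floors less than `d`; hence claim 1.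

In claims 2 and 3 the floors with `p > d` vanish. In claim 4 all the counts are sharp, so the
remainders of `d` modulo the three orders add up to at least 5, and a finite search remains
(`one_div_add_one_div_ge`).

Monodromy is handled without constructing a representation: solutions are lifted to left half-planes
by `exp`, where a loop becomes the translation by `2πi`. -/

noncomputable section

/-! ### Local monodromy on half-planes, and its behaviour under pull-back. -/

namespace LinODE

open Topology

theorem pullback_congr {E : LinODE} {f g : ℂ → ℂ} {w : ℂ} (h : f =ᶠ[𝓝 w] g) :
    (E.pullback f).p w = (E.pullback g).p w ∧ (E.pullback f).q w = (E.pullback g).q w := by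
  have h1 := h.deriv.eq_of_nhds
  have h2 := h.deriv.deriv.eq_of_nhds
  simp only [pullback, h.eq_of_nhds, h1, h2, and_self]

theorem deriv_deriv_comp {f g : ℂ → ℂ} {w : ℂ} (hf : AnalyticAt ℂ f (g w))
    (hg : AnalyticAt ℂ g w) :
    deriv (deriv (f ∘ g)) w =
      deriv (deriv f) (g w) * deriv g w ^ 2 + deriv f (g w) * deriv (deriv g) w := by
  have h1 : deriv (f ∘ g) =ᶠ[𝓝 w] fun z => deriv f (g z) * deriv g z := by
    filter_upwards [hg.continuousAt.eventually hf.eventually_analyticAt,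
      hg.eventually_analyticAt] with z hz hz'
    exact deriv_comp z hz.differentiableAt hz'.differentiableAt
  have h2 : HasDerivAt (fun z => deriv f (g z)) (deriv (deriv f) (g w) * deriv g w) w :=
    hf.deriv.differentiableAt.hasDerivAt.comp w hg.differentiableAt.hasDerivAt
  rw [h1.deriv_eq, (h2.fun_mul hg.deriv.differentiableAt.hasDerivAt).deriv]
  ring

theorem pullback_pullback {E : LinODE} {f g : ℂ → ℂ} {w : ℂ} (hf : AnalyticAt ℂ f (g w))
    (hg : AnalyticAt ℂ g w) (hf' : deriv f (g w) ≠ 0) (hg' : deriv g w ≠ 0) :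
    ((E.pullback f).pullback g).p w = (E.pullback (f ∘ g)).p w ∧
      ((E.pullback f).pullback g).q w = (E.pullback (f ∘ g)).q w := by
  have h1 : deriv (f ∘ g) w = deriv f (g w) * deriv g w :=
    deriv_comp w hf.differentiableAt hg.differentiableAt
  simp only [pullback, deriv_deriv_comp hf hg, h1, Function.comp]
  constructor
  · field_simp
    ring
  · ring

/-- A solution composed with a change of variable solves the pulled back equation. -/
theorem pullback_eq_zero_of_comp {F : LinODE} {u g : ℂ → ℂ} {w : ℂ} (hu : AnalyticAt ℂ u (g w))
    (hg : AnalyticAt ℂ g w) (hg' : deriv g w ≠ 0)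
    (h : deriv (deriv u) (g w) + F.p (g w) * deriv u (g w) + F.q (g w) * u (g w) = 0) :
    deriv (deriv (u ∘ g)) w + (F.pullback g).p w * deriv (u ∘ g) w +
      (F.pullback g).q w * (u ∘ g) w = 0 := by
  have h1 : deriv (u ∘ g) w = deriv u (g w) * deriv g w :=
    deriv_comp w hu.differentiableAt hg.differentiableAt
  rw [deriv_deriv_comp hu hg, h1]
  simp only [pullback, Function.comp]
  field_simp
  linear_combination deriv g w ^ 2 * h

theorem eventually_atBot_forall_re_lt {P : ℂ → Prop} :
    (∀ᶠ ρ : ℝ in atBot, ∀ w : ℂ, w.re < ρ → P w) ↔ ∀ᶠ w in comap Complex.re atBot, P w := by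
  rw [eventually_comap, eventually_atBot, eventually_atBot]
  constructor
  · rintro ⟨a, ha⟩
    exact ⟨a - 1, fun b hb w hw => ha a le_rfl w (by linarith)⟩
  · rintro ⟨a, ha⟩
    exact ⟨a, fun b hb w hw => ha w.re (by linarith) w rfl⟩

theorem isOpen_re_lt (ρ : ℝ) : IsOpen {w : ℂ | w.re < ρ} :=
  isOpen_lt Complex.continuous_re continuous_const

/-- For an equation on a left half-plane, the `n`-th power of the translation by `2πi` acts on the
solutions as a nonzero scalar. -/
def HasTrivialPow (F : LinODE) (n : ℕ) : Prop :=
  ∀ᶠ ρ : ℝ in atBot, ∃ c : ℂ, c ≠ 0 ∧ ∀ u : ℂ → ℂ, F.IsSolutionOn {w | w.re < ρ} u →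
    ∀ w : ℂ, w.re < ρ → u (w + n * (2 * Real.pi * Complex.I)) = c * u w

theorem re_add_period (w : ℂ) (n : ℕ) : (w + n * (2 * Real.pi * Complex.I)).re = w.re := by
  simp

theorem HasTrivialPow.sub {F : LinODE} {m n : ℕ} (hn : F.HasTrivialPow n)
    (hm : F.HasTrivialPow m) (hmn : m ≤ n) : F.HasTrivialPow (n - m) := by
  filter_upwards [hn, hm] with ρ ⟨c, hc, h⟩ ⟨c', hc', h'⟩
  refine ⟨c / c', div_ne_zero hc hc', fun u hu w hw => ?_⟩
  have h1 := h u hu w hw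
  have h2 := h' u hu (w + (n - m : ℕ) * (2 * Real.pi * Complex.I)) (by rwa [re_add_period])
  have h3 : w + (n - m : ℕ) * (2 * Real.pi * Complex.I) + m * (2 * Real.pi * Complex.I) =
      w + n * (2 * Real.pi * Complex.I) := by
    push_cast [hmn]
    ring
  rw [h3, h1] at h2
  rw [div_mul_eq_mul_div, h2, mul_div_cancel_left₀ _ hc']

/-- Euclid's algorithm replaces the group structure: differences of trivial exponents are trivial.
-/
theorem HasTrivialPow.mod {F : LinODE} {m : ℕ} (hm : F.HasTrivialPow m) (n : ℕ)
    (hn : F.HasTrivialPow n) : F.HasTrivialPow (n % m) := by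
  induction n using Nat.strong_induction_on with
  | _ n ih =>
    rcases Nat.eq_zero_or_pos m with rfl | h0
    · simpa using hn
    rcases lt_or_ge n m with h | h
    · rwa [Nat.mod_eq_of_lt h]
    · rw [Nat.mod_eq_sub_mod h]
      exact ih _ (by omega) (hn.sub hm h)

/-- If `G` is the pull-back of `F` under a map of half-planes that carries the translation by
`2πi` to its `k`-th multiple, triviality for `G` gives triviality of the `k`-th power for `F`. -/
theorem HasTrivialPow.of_pullback {F G : LinODE} {Λ : ℂ → ℂ} {k : ℕ}
    (han : ∀ᶠ w in comap Complex.re atBot, AnalyticAt ℂ Λ w ∧ deriv Λ w ≠ 0)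
    (hper : ∀ w, Λ (w + 2 * Real.pi * Complex.I) = Λ w + k * (2 * Real.pi * Complex.I))
    (heq : ∀ᶠ w in comap Complex.re atBot,
      G.p w = (F.pullback Λ).p w ∧ G.q w = (F.pullback Λ).q w)
    (hlim : Tendsto (fun w => (Λ w).re) (comap Complex.re atBot) atBot)
    (h : G.HasTrivialPow 1) : F.HasTrivialPow k := by
  -- Any `r` works: `Λ` maps some half-plane `Re w < ρ` into `Re z < r`, and the scalar found for
  -- `G` there serves for `F`.
  refine Eventually.of_forall fun r => ?_
  obtain ⟨ρ, h1, h2, h3, c, hc, hG⟩ := ((eventually_atBot_forall_re_lt.2 han).and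
    ((eventually_atBot_forall_re_lt.2 heq).and
      ((eventually_atBot_forall_re_lt.2 (hlim.eventually_lt_atBot r)).and h))).exists
  refine ⟨c, hc, fun u hu => ?_⟩
  have hua : AnalyticOnNhd ℂ u {w | w.re < r} := hu.1.analyticOnNhd (isOpen_re_lt r)
  have hv : G.IsSolutionOn {w | w.re < ρ} (u ∘ Λ) := by
    refine ⟨fun w hw => ?_, fun w hw => ?_⟩
    · exact ((hua _ (h3 w hw)).comp (h1 w hw).1).differentiableAt.differentiableWithinAt
    · rw [(h2 w hw).1, (h2 w hw).2]
      exact pullback_eq_zero_of_comp (hua _ (h3 w hw)) (h1 w hw).1 (h1 w hw).2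
        (hu.2 _ (h3 w hw))
  have key : ∀ w : ℂ, w.re < ρ →
      u (Λ w + k * (2 * Real.pi * Complex.I)) - c * u (Λ w) = 0 := by
    intro w hw
    have := hG _ hv w hw
    simp only [Function.comp, Nat.cast_one, one_mul, hper] at this
    rw [this, sub_self]
  have hfa : AnalyticOnNhd ℂ (fun z => u (z + k * (2 * Real.pi * Complex.I)) - c * u z)
      {w | w.re < r} := by
    intro z hz
    refine AnalyticAt.sub ?_ (analyticAt_const.mul (hua z hz))
    exact AnalyticAt.fun_comp (f := fun z => z + k * (2 * Real.pi * Complex.I))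
      (hua _ (by simpa using hz)) (analyticAt_id.add analyticAt_const)
  have hw0 : ((ρ - 1 : ℝ) : ℂ).re < ρ := by simp
  have hz0 : (fun z => u (z + k * (2 * Real.pi * Complex.I)) - c * u z)
      -- `Λ` is locally open since its derivative is nonzero, so the relation holds on a
      -- neighbourhood of an image point; the identity theorem then spreads it over the half-plane.
      =ᶠ[𝓝 (Λ ((ρ - 1 : ℝ) : ℂ))] 0 := by
    rw [← ((h1 _ hw0).1.hasStrictDerivAt).map_nhds_eq (h1 _ hw0).2]
    exact eventually_map.2 (((isOpen_re_lt ρ).eventually_mem hw0).mono fun w hw => key w hw)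
  intro w hw
  have := hfa.eqOn_zero_of_preconnected_of_eventuallyEq_zero
    (convex_halfSpace_re_lt r).isPreconnected (h3 _ hw0) hz0 hw
  exact sub_eq_zero.1 this

/-- The universal covering of a punctured neighbourhood of a point of the projective line. -/
def cover : OnePoint ℂ → ℂ → ℂ
  | .infty => fun w => (Complex.exp w)⁻¹
  | .some a => fun w => a + Complex.exp w

theorem analyticAt_cover (t : OnePoint ℂ) (w : ℂ) : AnalyticAt ℂ (cover t) w := by
  cases t with
  | infty => exact analyticAt_cexp.inv (Complex.exp_ne_zero w)
  | coe a => exact analyticAt_const.add analyticAt_cexp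

theorem deriv_cover_ne_zero (t : OnePoint ℂ) (w : ℂ) : deriv (cover t) w ≠ 0 := by
  cases t with
  | infty =>
    have : HasDerivAt (cover OnePoint.infty) (-Complex.exp w / Complex.exp w ^ 2) w :=
      (Complex.hasDerivAt_exp w).inv (Complex.exp_ne_zero w)
    rw [this.deriv]
    simp
  | coe a =>
    have : HasDerivAt (cover (a : OnePoint ℂ)) (Complex.exp w) w :=
      (Complex.hasDerivAt_exp w).const_add a
    rw [this.deriv]
    exact Complex.exp_ne_zero w

theorem orderAt_eq (E : LinODE) (t : OnePoint ℂ) :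
    E.orderAt t = ⨅ n ∈ {n : ℕ | 0 < n ∧ (E.pullback (cover t)).HasTrivialPow n}, (n : ℕ∞) := by
  cases t with
  | infty =>
    have h : ((E.pullback fun s => s⁻¹).pullback fun w => 0 + Complex.exp w) =
        E.pullback (cover OnePoint.infty) := by
      have h0 : (cover OnePoint.infty) = (fun s : ℂ => s⁻¹) ∘ fun w => 0 + Complex.exp w := by
        funext w
        simp [cover]
      have h1 : ∀ w, _ := fun w => pullback_pullback (E := E) (f := fun s : ℂ => s⁻¹)
        (g := fun w => 0 + Complex.exp w) (w := w)
        (analyticAt_inv (by simp)) (by fun_prop) (by simp) (by simp)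
      rw [h0]
      have ext' : ∀ F G : LinODE, (∀ w, F.p w = G.p w ∧ F.q w = G.q w) → F = G := by
        rintro ⟨p, q⟩ ⟨p', q'⟩ h
        rw [LinODE.mk.injEq]
        exact ⟨funext fun w => (h w).1, funext fun w => (h w).2⟩
      exact ext' _ _ h1
    rw [← h]
    rfl
  | coe a => rfl

theorem hasTrivialPow_one_of_orderAt_eq_one {E : LinODE} {t : OnePoint ℂ}
    (h : E.orderAt t = 1) : (E.pullback (cover t)).HasTrivialPow 1 := by
  by_contra h1
  have : (2 : ℕ∞) ≤ E.orderAt t := by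
    rw [orderAt_eq]
    refine le_iInf₂ fun n hn => ?_
    have : n ≠ 1 := by
      rintro rfl
      exact h1 hn.2
    have h2 : 2 ≤ n := by have := hn.1; omega
    exact_mod_cast h2
  rw [h] at this
  exact absurd this (by decide)

theorem one_le_orderAt (E : LinODE) (t : OnePoint ℂ) : 1 ≤ E.orderAt t := by
  rw [orderAt_eq]
  refine le_iInf₂ fun n hn => ?_
  exact_mod_cast hn.1

/-- The order is the least positive trivial exponent, and the remainder of `n` modulo it is again
trivial, hence zero. -/
theorem toNat_orderAt_dvd {E : LinODE} {t : OnePoint ℂ} {n : ℕ} (hn : 0 < n)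
    (h : (E.pullback (cover t)).HasTrivialPow n) : (E.orderAt t).toNat ∣ n := by
  classical
  have hex : ∃ m, 0 < m ∧ (E.pullback (cover t)).HasTrivialPow m := ⟨n, hn, h⟩
  have hs := Nat.find_spec hex
  have hE : E.orderAt t = (Nat.find hex : ℕ) := by
    rw [orderAt_eq]
    refine le_antisymm (iInf₂_le (f := fun (n : ℕ) _ => (n : ℕ∞)) _ hs) (le_iInf₂ fun m hm => ?_)
    exact_mod_cast Nat.find_min' hex hm
  rw [hE, ENat.toNat_natCast]
  refine Nat.dvd_of_mod_eq_zero ?_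
  by_contra h0
  exact Nat.find_min hex (Nat.mod_lt n hs.1) ⟨Nat.pos_of_ne_zero h0, hs.2.mod n h⟩

/-- The local monodromy of a pull-back: if `φ` is given by `L` in the covering coordinates, with
ramification index `k`, and the pull-back has trivial local monodromy, then the `k`-th power of
the local monodromy of the original equation is trivial. -/
theorem HasTrivialPow.of_pullback_cover {E : LinODE} {f L : ℂ → ℂ} {t c : OnePoint ℂ} {k : ℕ}
    (hk : 0 < k) (hL : AnalyticAt ℂ L 0)
    (hf : ∀ᶠ w in comap Complex.re atBot,
      AnalyticAt ℂ f (cover t w) ∧ deriv f (cover t w) ≠ 0)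
    (heq : ∀ᶠ w in comap Complex.re atBot,
      f (cover t w) = cover c (k * w + L (Complex.exp w)))
    (h : ((E.pullback f).pullback (cover t)).HasTrivialPow 1) :
    (E.pullback (cover c)).HasTrivialPow k := by
  have hexp : Tendsto Complex.exp (comap Complex.re atBot) (𝓝 0) :=
    Complex.tendsto_exp_comap_re_atBot
  have hloc : ∀ {P : ℂ → Prop}, (∀ᶠ w in comap Complex.re atBot, P w) →
      ∀ᶠ w in comap Complex.re atBot, ∀ᶠ z in 𝓝 w, P z := by
    intro P hP
    rw [← eventually_atBot_forall_re_lt] at hP ⊢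
    filter_upwards [hP] with ρ hρ w hw
    exact ((isOpen_re_lt ρ).eventually_mem hw).mono fun z hz => hρ z hz
  have hΛ : ∀ᶠ w in comap Complex.re atBot,
      AnalyticAt ℂ (fun w => k * w + L (Complex.exp w)) w := by
    filter_upwards [hexp.eventually hL.eventually_analyticAt] with w hw
    exact (analyticAt_const.mul analyticAt_id).add (hw.fun_comp analyticAt_cexp)
  -- By the chain rule applied to `heq`, a critical point of the lift would be one of `f ∘ cover t`.
  have hΛ' : ∀ᶠ w in comap Complex.re atBot,
      deriv (fun w => k * w + L (Complex.exp w)) w ≠ 0 := by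
    filter_upwards [hΛ, hf, hloc heq] with w h1 h2 h3 h0
    have h4 : deriv (f ∘ cover t) w =
        deriv (cover c ∘ fun w => k * w + L (Complex.exp w)) w := EventuallyEq.deriv_eq h3
    rw [deriv_comp w h2.1.differentiableAt (analyticAt_cover t w).differentiableAt,
      deriv_comp w (analyticAt_cover c _).differentiableAt h1.differentiableAt, h0,
      mul_zero] at h4
    exact mul_ne_zero h2.2 (deriv_cover_ne_zero t w) h4
  refine HasTrivialPow.of_pullback (Λ := fun w => k * w + L (Complex.exp w))
    (hΛ.and hΛ') (fun w => ?_) ?_ ?_ h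
  · rw [Complex.exp_periodic w]
    ring
  · filter_upwards [hΛ, hΛ', hf, hloc heq] with w h1 h1' h2 h3
    have e1 := pullback_pullback (E := E) h2.1 (analyticAt_cover t w) h2.2
      (deriv_cover_ne_zero t w)
    have e2 := pullback_pullback (E := E) (analyticAt_cover c _) h1
      (deriv_cover_ne_zero c _) h1'
    have e3 := pullback_congr (E := E) (f := f ∘ cover t)
      (g := cover c ∘ fun w => k * w + L (Complex.exp w)) h3
    exact ⟨e1.1.trans (e3.1.trans e2.1.symm), e1.2.trans (e3.2.trans e2.2.symm)⟩
  · have h1 : Tendsto (fun w : ℂ => (k : ℝ) * w.re) (comap Complex.re atBot) atBot :=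
      tendsto_comap.const_mul_atBot (by exact_mod_cast hk)
    have h2 : Tendsto (fun w => (L (Complex.exp w)).re) (comap Complex.re atBot)
        (𝓝 (L 0).re) :=
      (Complex.continuous_re.tendsto _).comp (hL.continuousAt.tendsto.comp hexp)
    simpa using h1.atBot_add h2

end LinODE

/-! ### Fibres of rational functions and the Riemann–Hurwitz inequality. -/

namespace RatMap

open Topology

variable {φ : RatFunc ℂ}

theorem natDegree_num_le (φ : RatFunc ℂ) : φ.num.natDegree ≤ degree φ := le_max_left _ _

theorem natDegree_denom_le (φ : RatFunc ℂ) : φ.denom.natDegree ≤ degree φ := le_max_right _ _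

/-- A polynomial that completes the fibre polynomial to a pair of homogeneous coordinates. -/
def coFibrePoly (φ : RatFunc ℂ) : OnePoint ℂ → ℂ[X]
  | .infty => -φ.num
  | .some _ => φ.denom

theorem natDegree_fibrePoly_le (φ : RatFunc ℂ) (c : OnePoint ℂ) :
    (fibrePoly φ c).natDegree ≤ degree φ := by
  cases c with
  | infty => exact natDegree_denom_le φ
  | coe c =>
    refine (natDegree_sub_le _ _).trans (max_le (natDegree_num_le φ) ?_)
    exact (natDegree_C_mul_le _ _).trans (natDegree_denom_le φ)

theorem natDegree_coFibrePoly_le (φ : RatFunc ℂ) (c : OnePoint ℂ) :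
    (coFibrePoly φ c).natDegree ≤ degree φ := by
  cases c with
  | infty => exact (natDegree_neg _).trans_le (natDegree_num_le φ)
  | coe c => exact natDegree_denom_le φ

theorem isCoprime_fibrePoly (φ : RatFunc ℂ) (c : OnePoint ℂ) :
    IsCoprime (fibrePoly φ c) (coFibrePoly φ c) := by
  cases c with
  | infty => exact (RatFunc.isCoprime_num_denom φ).symm.neg_right
  | coe c =>
    have := (RatFunc.isCoprime_num_denom φ).add_mul_right_left (-C c)
    rwa [neg_mul, ← sub_eq_add_neg] at this

/-- One polynomial, independent of `c`, records the finite ramification of all fibres. The sign in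
`coFibrePoly` at `∞` is chosen for this. -/
theorem wronskian_fibrePoly (φ : RatFunc ℂ) (c : OnePoint ℂ) :
    wronskian (fibrePoly φ c) (coFibrePoly φ c) = wronskian φ.num φ.denom := by
  cases c with
  | infty =>
    change wronskian φ.denom (-φ.num) = _
    rw [wronskian_neg_right, wronskian_neg_eq]
  | coe c =>
    change wronskian (φ.num - C c * φ.denom) φ.denom = _
    simp only [wronskian, derivative_sub, derivative_C_mul]
    ring

theorem wronskian_ne_zero (hd : 0 < degree φ) : wronskian φ.num φ.denom ≠ 0 := by
  intro h
  rw [(RatFunc.isCoprime_num_denom φ).wronskian_eq_zero_iff] at h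
  have h1 := derivative_eq_zero.1 h.1
  have h2 := derivative_eq_zero.1 h.2
  simp [degree, h1, h2] at hd

theorem fibrePoly_ne_zero (hd : 0 < degree φ) (c : OnePoint ℂ) : fibrePoly φ c ≠ 0 := by
  intro h
  apply wronskian_ne_zero hd
  rw [← wronskian_fibrePoly φ c, h, wronskian_zero_left]

theorem coFibrePoly_ne_zero (hd : 0 < degree φ) (c : OnePoint ℂ) : coFibrePoly φ c ≠ 0 := by
  intro h
  apply wronskian_ne_zero hd
  rw [← wronskian_fibrePoly φ c, h, wronskian_zero_right]

theorem eval_coFibrePoly_ne_zero {c : OnePoint ℂ} {z : ℂ} (h : (fibrePoly φ c).IsRoot z) :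
    (coFibrePoly φ c).eval z ≠ 0 := by
  intro h'
  obtain ⟨a, b, hab⟩ := isCoprime_fibrePoly φ c
  have := congrArg (eval z) hab
  rw [IsRoot.def] at h
  simp [h, h'] at this

theorem map_coe_eq_iff {z : ℂ} {c : OnePoint ℂ} :
    map φ (z : OnePoint ℂ) = c ↔ (fibrePoly φ c).IsRoot z := by
  change (if φ.denom.eval z = 0 then OnePoint.infty else ((affine φ z : ℂ) : OnePoint ℂ)) = c ↔ _
  cases c with
  | infty =>
    change _ ↔ φ.denom.eval z = 0
    split_ifs with h <;> simp [h]
  | coe c =>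
    split_ifs with h
    · refine iff_of_false (by simp) fun h' => ?_
      exact eval_coFibrePoly_ne_zero h' h
    · change _ ↔ (φ.num - C c * φ.denom).IsRoot z
      rw [OnePoint.coe_eq_coe, affine, div_eq_iff h, IsRoot.def, eval_sub, eval_mul, eval_C,
        sub_eq_zero]

theorem map_infty_eq_iff (hd : 0 < degree φ) {c : OnePoint ℂ} :
    map φ OnePoint.infty = c ↔ (fibrePoly φ c).natDegree < degree φ := by
  change (if φ.denom.natDegree < φ.num.natDegree then OnePoint.infty
      else ((φ.num.coeff φ.denom.natDegree / φ.denom.leadingCoeff : ℂ) : OnePoint ℂ)) = c ↔ _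
  cases c with
  | infty =>
    change _ ↔ φ.denom.natDegree < max _ _
    split_ifs with h
    · simp [h]
    · simpa using h
  | coe c =>
    have hc := fibrePoly_ne_zero hd (c : OnePoint ℂ)
    have hle := natDegree_fibrePoly_le φ (c : OnePoint ℂ)
    change φ.num - C c * φ.denom ≠ 0 at hc
    change (φ.num - C c * φ.denom).natDegree ≤ _ at hle
    change _ ↔ (φ.num - C c * φ.denom).natDegree < _
    have hlc : φ.denom.leadingCoeff ≠ 0 := leadingCoeff_ne_zero.2 φ.denom_ne_zero
    split_ifs with h
    · refine iff_of_false (by simp) (not_lt.2 ?_)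
      rw [degree, max_eq_left h.le]
      apply le_natDegree_of_ne_zero
      rw [coeff_sub, coeff_C_mul, coeff_eq_zero_of_natDegree_lt h, mul_zero, sub_zero]
      apply leadingCoeff_ne_zero.2
      rintro h0
      simp [h0] at h
    · rw [OnePoint.coe_eq_coe, div_eq_iff hlc]
      have hdeg : degree φ = φ.denom.natDegree := max_eq_right (not_lt.1 h)
      rw [hdeg] at hle ⊢
      have hcoeff : (φ.num - C c * φ.denom).coeff φ.denom.natDegree =
          φ.num.coeff φ.denom.natDegree - c * φ.denom.leadingCoeff := by
        rw [coeff_sub, coeff_C_mul, leadingCoeff]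
      rw [← sub_eq_zero, ← hcoeff]
      constructor
      · intro h0
        refine lt_of_le_of_ne hle fun h1 => leadingCoeff_ne_zero.2 hc ?_
        rw [leadingCoeff, h1, h0]
      · exact fun h0 => coeff_eq_zero_of_natDegree_lt h0

theorem natDegree_coFibrePoly (c : OnePoint ℂ)
    (h : (fibrePoly φ c).natDegree < degree φ) : (coFibrePoly φ c).natDegree = degree φ := by
  cases c with
  | infty =>
    change φ.denom.natDegree < max _ _ at h
    change (-φ.num).natDegree = max _ _
    rw [natDegree_neg]
    omega
  | coe c =>
    change φ.denom.natDegree = max _ _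
    change (φ.num - C c * φ.denom).natDegree < max _ _ at h
    by_contra h0
    have h1 : φ.denom.natDegree < φ.num.natDegree := by omega
    rw [natDegree_sub_eq_left_of_natDegree_lt
      ((natDegree_C_mul_le _ _).trans_lt h1)] at h
    omega

theorem ramIdx_pos (hd : 0 < degree φ) (t : OnePoint ℂ) : 0 < ramIdx φ t := by
  cases t with
  | infty => exact Nat.sub_pos_of_lt ((map_infty_eq_iff hd).1 rfl)
  | coe z => exact (rootMultiplicity_pos (fibrePoly_ne_zero hd _)).2 (map_coe_eq_iff.1 rfl)

open Classical in
/-- The points of the projective line above `c`. -/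
def fibre (φ : RatFunc ℂ) (c : OnePoint ℂ) : Finset (OnePoint ℂ) :=
  (fibrePoly φ c).roots.toFinset.image (fun z : ℂ => (z : OnePoint ℂ)) ∪
    if map φ OnePoint.infty = c then {OnePoint.infty} else ∅

theorem mem_fibre (hd : 0 < degree φ) {c t : OnePoint ℂ} : t ∈ fibre φ c ↔ map φ t = c := by
  classical
  cases t with
  | infty =>
    rw [fibre]
    split_ifs with h <;> simp [h]
  | coe z =>
    have h1 : (z : OnePoint ℂ) ∉
        (if map φ OnePoint.infty = c then {OnePoint.infty} else ∅ : Finset (OnePoint ℂ)) := by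
      split_ifs <;> simp
    rw [fibre, Finset.mem_union, or_iff_left h1, map_coe_eq_iff]
    simp [fibrePoly_ne_zero hd c]

theorem sum_ramIdx_fibre (hd : 0 < degree φ) (c : OnePoint ℂ) :
    ∑ t ∈ fibre φ c, ramIdx φ t = degree φ := by
  classical
  have hinf : ∑ t ∈ (if map φ OnePoint.infty = c then {OnePoint.infty} else ∅ :
      Finset (OnePoint ℂ)), ramIdx φ t = degree φ - (fibrePoly φ c).natDegree := by
    split_ifs with h
    · rw [Finset.sum_singleton, ← h]
      rfl
    · rw [map_infty_eq_iff hd] at h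
      rw [Finset.sum_empty]
      omega
  have hfin : ∑ z ∈ (fibrePoly φ c).roots.toFinset, ramIdx φ (z : OnePoint ℂ) =
      (fibrePoly φ c).natDegree := by
    rw [← IsAlgClosed.card_roots_eq_natDegree (p := fibrePoly φ c), ← Multiset.toFinset_sum_count_eq]
    refine Finset.sum_congr rfl fun z hz => ?_
    have hz' : map φ (z : OnePoint ℂ) = c := by
      rw [map_coe_eq_iff]
      exact isRoot_of_mem_roots (Multiset.mem_toFinset.1 hz)
    rw [count_roots, ← hz']
    rfl
  rw [fibre, Finset.sum_union, Finset.sum_image (by simp), hfin, hinf]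
  · have := natDegree_fibrePoly_le φ c
    omega
  · rw [Finset.disjoint_left]
    intro t ht
    obtain ⟨z, -, rfl⟩ := Finset.mem_image.1 ht
    split_ifs <;> simp

/-- A factor `(X - z)^e` of the fibre polynomial leaves `(X - z)^(e-1)` in its derivative, hence in
the Wronskian. -/
theorem ramIdx_coe_sub_one_le (hd : 0 < degree φ) (z : ℂ) :
    ramIdx φ (z : OnePoint ℂ) - 1 ≤ (wronskian φ.num φ.denom).rootMultiplicity z := by
  rw [le_rootMultiplicity_iff (wronskian_ne_zero hd),
    ← wronskian_fibrePoly φ (map φ (z : OnePoint ℂ))]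
  have h1 : (X - C z) ^ ramIdx φ (z : OnePoint ℂ) ∣ fibrePoly φ (map φ (z : OnePoint ℂ)) :=
    pow_rootMultiplicity_dvd _ _
  have h2 := pow_sub_one_dvd_derivative_of_pow_dvd h1
  exact dvd_sub (((pow_dvd_pow _ (Nat.sub_le _ _)).trans h1).mul_right _) (h2.mul_right _)

/-- A nonzero Wronskian has degree strictly below the sum of the two degrees, and the fibre
polynomial through `∞` has degree `d - ramIdx φ ∞`. -/
theorem natDegree_wronskian_add_ramIdx_infty (hd : 0 < degree φ) :
    (wronskian φ.num φ.denom).natDegree + ramIdx φ OnePoint.infty < 2 * degree φ := by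
  have h1 := wronskian_fibrePoly φ (map φ OnePoint.infty)
  have h2 := natDegree_wronskian_lt_add (h1.trans_ne (wronskian_ne_zero hd))
  rw [h1] at h2
  have h3 := natDegree_coFibrePoly_le φ (map φ OnePoint.infty)
  have h4 := natDegree_fibrePoly_le φ (map φ OnePoint.infty)
  have h5 : ramIdx φ OnePoint.infty =
    degree φ - (fibrePoly φ (map φ OnePoint.infty)).natDegree := rfl
  omega

/-- The Riemann–Hurwitz inequality for rational functions. -/
theorem sum_ramIdx_sub_one_le (hd : 0 < degree φ) (T : Finset (OnePoint ℂ)) :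
    ∑ t ∈ T, (ramIdx φ t - 1) + 2 ≤ 2 * degree φ := by
  classical
  set W := wronskian φ.num φ.denom with hW
  have hinj : Function.Injective (fun z : ℂ => (z : OnePoint ℂ)) := OnePoint.coe_injective
  set T₀ : Finset ℂ := T.preimage (fun z : ℂ => (z : OnePoint ℂ)) hinj.injOn with hT₀
  have hsub : T ⊆ insert OnePoint.infty (T₀.image fun z : ℂ => (z : OnePoint ℂ)) := by
    intro t ht
    cases t with
    | infty => exact Finset.mem_insert_self _ _
    | coe z => exact Finset.mem_insert_of_mem (Finset.mem_image_of_mem _ (by simpa [hT₀] using ht))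
  have h1 : ∑ z ∈ T₀, (ramIdx φ (z : OnePoint ℂ) - 1) ≤ W.natDegree := by
    calc ∑ z ∈ T₀, (ramIdx φ (z : OnePoint ℂ) - 1)
        ≤ ∑ z ∈ T₀, W.roots.count z := Finset.sum_le_sum fun z _ => by
          rw [count_roots]
          exact ramIdx_coe_sub_one_le hd z
      _ ≤ ∑ z ∈ T₀ ∪ W.roots.toFinset, W.roots.count z :=
          Finset.sum_le_sum_of_subset Finset.subset_union_left
      _ = W.roots.card := Multiset.sum_count_eq_card fun z hz =>
          Finset.mem_union_right _ (Multiset.mem_toFinset.2 hz)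
      _ ≤ W.natDegree := card_roots' W
  have h2 := Finset.sum_le_sum_of_subset (f := fun t => ramIdx φ t - 1) hsub
  rw [Finset.sum_insert (by simp), Finset.sum_image (by simp)] at h2
  have h3 := natDegree_wronskian_add_ramIdx_infty hd
  rw [← hW] at h3
  have h4 := ramIdx_pos hd OnePoint.infty
  omega

/-! ### Lifting a rational function to the coverings. -/

/-- The order of a polynomial at a point of the projective line. -/
def ordAt (P : ℂ[X]) : OnePoint ℂ → ℤ
  | .infty => -P.natDegree
  | .some z => P.rootMultiplicity z

theorem ramIdx_eq_ordAt_sub (hd : 0 < degree φ) (t : OnePoint ℂ) :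
    (ramIdx φ t : ℤ) = ordAt (fibrePoly φ (map φ t)) t - ordAt (coFibrePoly φ (map φ t)) t := by
  cases t with
  | infty =>
    have h1 := (map_infty_eq_iff hd).1 (rfl : map φ OnePoint.infty = _)
    have h2 := natDegree_coFibrePoly _ h1
    change ((degree φ - (fibrePoly φ (map φ OnePoint.infty)).natDegree : ℕ) : ℤ) =
      -((fibrePoly φ (map φ OnePoint.infty)).natDegree : ℤ) -
        -((coFibrePoly φ (map φ OnePoint.infty)).natDegree : ℤ)
    omega
  | coe z =>
    have h1 : (fibrePoly φ (map φ (z : OnePoint ℂ))).IsRoot z := map_coe_eq_iff.1 rfl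
    have h2 : (coFibrePoly φ (map φ (z : OnePoint ℂ))).rootMultiplicity z = 0 :=
      rootMultiplicity_eq_zero (eval_coFibrePoly_ne_zero h1)
    change ((fibrePoly φ (map φ (z : OnePoint ℂ))).rootMultiplicity z : ℤ) =
      (fibrePoly φ (map φ (z : OnePoint ℂ))).rootMultiplicity z -
        (coFibrePoly φ (map φ (z : OnePoint ℂ))).rootMultiplicity z
    omega

theorem exists_eval_cover_eq {P : ℂ[X]} (hP : P ≠ 0) (t : OnePoint ℂ) :
    ∃ A : ℂ[X], A.eval 0 ≠ 0 ∧ ∀ w : ℂ,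
      P.eval (LinODE.cover t w) = Complex.exp w ^ ordAt P t * A.eval (Complex.exp w) := by
  cases t with
  | infty =>
    refine ⟨P.reverse, ?_, fun w => ?_⟩
    · rwa [← coeff_zero_eq_eval_zero, coeff_zero_reverse, leadingCoeff_ne_zero]
    · have hw := Complex.exp_ne_zero w
      let _ : Invertible (Complex.exp w)⁻¹ := invertibleOfNonzero (inv_ne_zero hw)
      have h := eval₂_reverse_mul_pow (RingHom.id ℂ) (Complex.exp w)⁻¹ P
      rw [invOf_eq_inv, inv_inv] at h
      change P.eval (Complex.exp w)⁻¹ =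
        Complex.exp w ^ (-(P.natDegree : ℤ)) * P.reverse.eval (Complex.exp w)
      rw [zpow_neg, zpow_natCast, mul_comm, ← inv_pow]
      exact h.symm
  | coe z =>
    obtain ⟨M, hM, hM'⟩ := exists_eq_pow_rootMultiplicity_mul_and_not_dvd P hP z
    refine ⟨M.comp (C z + X), ?_, fun w => ?_⟩
    · rw [dvd_iff_isRoot, IsRoot.def] at hM'
      simpa using hM'
    · change P.eval (z + Complex.exp w) = Complex.exp w ^ ((P.rootMultiplicity z : ℕ) : ℤ) * _
      conv_lhs => rw [hM]
      simp

theorem tendsto_cover_cofinite (t : OnePoint ℂ) :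
    Tendsto (LinODE.cover t) (comap Complex.re atBot) cofinite := by
  have h := Complex.tendsto_exp_comap_re_atBot_nhdsNE
  cases t with
  | infty => exact (tendsto_inv₀_nhdsNE_zero.comp h).mono_right (Bornology.le_cofinite _)
  | coe z =>
    refine Tendsto.mono_right ?_ (nhdsNE_le_cofinite z)
    refine tendsto_nhdsWithin_iff.2 ⟨?_, Eventually.of_forall fun w => ?_⟩
    · simpa using! Complex.tendsto_exp_comap_re_atBot.const_add z
    · simp [LinODE.cover]

theorem eventually_eval_cover_ne_zero {P : ℂ[X]} (hP : P ≠ 0) (t : OnePoint ℂ) :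
    ∀ᶠ w in comap Complex.re atBot, P.eval (LinODE.cover t w) ≠ 0 := by
  have : ∀ᶠ z in cofinite, P.eval z ≠ 0 := by
    refine (P.roots.toFinset.finite_toSet.subset fun z hz => ?_)
    simpa [hP] using hz
  exact (tendsto_cover_cofinite t).eventually this

theorem hasDerivAt_affine {z : ℂ} (hz : φ.denom.eval z ≠ 0) :
    HasDerivAt (affine φ) (-(wronskian φ.num φ.denom).eval z / φ.denom.eval z ^ 2) z := by
  refine ((φ.num.hasDerivAt z).fun_div (φ.denom.hasDerivAt z) hz).congr_deriv ?_
  simp only [wronskian, eval_sub, eval_mul]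
  ring

theorem eventually_affine_regular (hd : 0 < degree φ) (t : OnePoint ℂ) :
    ∀ᶠ w in comap Complex.re atBot, AnalyticAt ℂ (affine φ) (LinODE.cover t w) ∧
      deriv (affine φ) (LinODE.cover t w) ≠ 0 := by
  filter_upwards [eventually_eval_cover_ne_zero φ.denom_ne_zero t,
    eventually_eval_cover_ne_zero (wronskian_ne_zero hd) t] with w h1 h2
  constructor
  · exact (AnalyticOnNhd.eval_polynomial φ.num _ trivial).div
      (AnalyticOnNhd.eval_polynomial φ.denom _ trivial) h1
  · rw [(hasDerivAt_affine h1).deriv]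
    exact div_ne_zero (neg_ne_zero.2 h2) (pow_ne_zero _ h1)

theorem exists_analytic_log {h : ℂ → ℂ} {a : ℂ} (hh : AnalyticAt ℂ h a) (h0 : h a ≠ 0) :
    ∃ L : ℂ → ℂ, AnalyticAt ℂ L a ∧ ∀ᶠ s in 𝓝 a, Complex.exp (L s) = h s := by
  have h1 : AnalyticAt ℂ (fun s => h s / h a) a := hh.div analyticAt_const h0
  refine ⟨fun s => Complex.log (h a) + Complex.log (h s / h a),
    analyticAt_const.add (h1.clog (by simp [h0])), ?_⟩
  filter_upwards [hh.continuousAt.eventually_ne h0] with s hs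
  rw [Complex.exp_add, Complex.exp_log h0, Complex.exp_log (div_ne_zero hs h0)]
  field_simp

/-- A rational function lifts to the universal coverings of punctured neighbourhoods. -/
theorem exists_lift (hd : 0 < degree φ) (t : OnePoint ℂ) :
    ∃ L : ℂ → ℂ, AnalyticAt ℂ L 0 ∧ ∀ᶠ w in comap Complex.re atBot,
      affine φ (LinODE.cover t w) =
        LinODE.cover (map φ t) (ramIdx φ t * w + L (Complex.exp w)) := by
  obtain ⟨A, hA, hA'⟩ := exists_eval_cover_eq (fibrePoly_ne_zero hd (map φ t)) t
  obtain ⟨B, hB, hB'⟩ := exists_eval_cover_eq (coFibrePoly_ne_zero hd (map φ t)) t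
  have hram := ramIdx_eq_ordAt_sub hd t
  generalize map φ t = c at hA' hB' hram ⊢
  have key : ∀ w, (fibrePoly φ c).eval (LinODE.cover t w) /
      (coFibrePoly φ c).eval (LinODE.cover t w) =
      Complex.exp w ^ ramIdx φ t * (A.eval (Complex.exp w) / B.eval (Complex.exp w)) := by
    intro w
    rw [hA', hB', ← zpow_natCast, hram, zpow_sub₀ (Complex.exp_ne_zero w)]
    ring
  -- The quotient of the two polynomials is the local coordinate at `c` up to `σ`; `σ = -1` undoes
  -- the sign in `coFibrePoly` at `∞`.
  have hσ : ∃ σ : ℂ, σ ≠ 0 ∧ ∀ w, (coFibrePoly φ c).eval (LinODE.cover t w) ≠ 0 →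
      ∀ v : ℂ, Complex.exp v = σ * ((fibrePoly φ c).eval (LinODE.cover t w) /
        (coFibrePoly φ c).eval (LinODE.cover t w)) →
      affine φ (LinODE.cover t w) = LinODE.cover c v := by
    cases c with
    | infty =>
      refine ⟨-1, by simp, fun w _ v hv => ?_⟩
      change _ = (Complex.exp v)⁻¹
      rw [hv, affine]
      simp [fibrePoly, coFibrePoly, div_neg]
    | coe c =>
      refine ⟨1, one_ne_zero, fun w hw v hv => ?_⟩
      change _ = c + Complex.exp v
      change φ.denom.eval _ ≠ 0 at hw
      rw [hv, affine]
      change _ = c + 1 * ((φ.num - C c * φ.denom).eval _ / φ.denom.eval _)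
      rw [eval_sub, eval_mul, eval_C]
      field_simp
      ring
  obtain ⟨σ, hσ0, hσ⟩ := hσ
  obtain ⟨L, hL, hL'⟩ := exists_analytic_log (a := 0)
    (h := fun s => σ * (A.eval s / B.eval s))
    (analyticAt_const.mul ((AnalyticOnNhd.eval_polynomial A 0 trivial).div
      (AnalyticOnNhd.eval_polynomial B 0 trivial) hB)) (mul_ne_zero hσ0 (div_ne_zero hA hB))
  refine ⟨L, hL, ?_⟩
  filter_upwards [Complex.tendsto_exp_comap_re_atBot.eventually hL',
    eventually_eval_cover_ne_zero (coFibrePoly_ne_zero hd c) t] with w h1 h2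
  refine hσ w h2 _ ?_
  rw [key, Complex.exp_add, h1, Complex.exp_nat_mul]
  ring

/-- The order of the local monodromy divides the ramification index at the points where the local
monodromy of the pull-back is trivial. -/
theorem toNat_orderAt_dvd_ramIdx (E : LinODE) (hd : 0 < degree φ) {t : OnePoint ℂ}
    (h : (E.pullback (affine φ)).orderAt t = 1) :
    (E.orderAt (map φ t)).toNat ∣ ramIdx φ t := by
  obtain ⟨L, hL, hL'⟩ := exists_lift hd t
  exact LinODE.toNat_orderAt_dvd (ramIdx_pos hd t) (LinODE.HasTrivialPow.of_pullback_cover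
    (ramIdx_pos hd t) hL (eventually_affine_regular hd t) hL'
    (LinODE.hasTrivialPow_one_of_orderAt_eq_one h))

end RatMap

/-! ### Counting points above `0`, `1`, `∞`. -/

namespace RatMap

variable {φ : RatFunc ℂ}

theorem ramIdx_le_degree (φ : RatFunc ℂ) (t : OnePoint ℂ) : ramIdx φ t ≤ degree φ := by
  cases t with
  | infty => exact Nat.sub_le _ _
  | coe z =>
    refine le_trans ?_ (natDegree_fibrePoly_le φ (map φ (z : OnePoint ℂ)))
    change (fibrePoly φ (map φ (z : OnePoint ℂ))).rootMultiplicity z ≤ _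
    rw [← count_roots]
    exact (Multiset.count_le_card _ _).trans (card_roots' _)

/-- The points above `c` whose ramification index is not a multiple of `m`. -/
def badFibre (φ : RatFunc ℂ) (c : OnePoint ℂ) (m : ℕ) : Finset (OnePoint ℂ) :=
  (fibre φ c).filter fun t => ¬ m ∣ ramIdx φ t

/-- The points above `c` whose ramification index is a multiple of `m`. -/
def goodFibre (φ : RatFunc ℂ) (c : OnePoint ℂ) (m : ℕ) : Finset (OnePoint ℂ) :=
  (fibre φ c).filter fun t => m ∣ ramIdx φ t

theorem card_goodFibre_add_card_badFibre (φ : RatFunc ℂ) (c : OnePoint ℂ) (m : ℕ) :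
    (goodFibre φ c m).card + (badFibre φ c m).card = (fibre φ c).card :=
  Finset.card_filter_add_card_filter_not _

theorem mul_card_goodFibre_add_card_badFibre_le (hd : 0 < degree φ) (c : OnePoint ℂ) (m : ℕ) :
    m * (goodFibre φ c m).card + (badFibre φ c m).card ≤ degree φ := by
  rw [← sum_ramIdx_fibre hd c,
    ← Finset.sum_filter_add_sum_filter_not (fibre φ c) fun t => m ∣ ramIdx φ t]
  refine add_le_add ?_ ?_
  · rw [mul_comm, ← smul_eq_mul]
    exact Finset.card_nsmul_le_sum _ _ _ fun t ht =>
      Nat.le_of_dvd (ramIdx_pos hd t) (Finset.mem_filter.1 ht).2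
  · have := Finset.card_nsmul_le_sum (badFibre φ c m) (ramIdx φ) 1 fun t _ => ramIdx_pos hd t
    simpa using! this

/-- The modulus 0 stands for infinite order, since `toNat` sends `⊤` to 0. -/
theorem card_goodFibre_zero (hd : 0 < degree φ) (c : OnePoint ℂ) :
    (goodFibre φ c 0).card = 0 := by
  rw [Finset.card_eq_zero, goodFibre, Finset.filter_eq_empty_iff]
  intro t _ h
  exact (ramIdx_pos hd t).ne' (Nat.eq_zero_of_zero_dvd h)

theorem card_goodFibre_le (hd : 0 < degree φ) (c : OnePoint ℂ) (m : ℕ) :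
    (goodFibre φ c m).card ≤ degree φ / m := by
  rcases Nat.eq_zero_or_pos m with rfl | hm
  · simp [card_goodFibre_zero hd c]
  · rw [Nat.le_div_iff_mul_le hm, mul_comm]
    exact (Nat.le_add_right _ _).trans (mul_card_goodFibre_add_card_badFibre_le hd c m)

theorem sum_ramIdx_sub_one_add_card (hd : 0 < degree φ) (c : OnePoint ℂ) :
    ∑ t ∈ fibre φ c, (ramIdx φ t - 1) + (fibre φ c).card = degree φ := by
  rw [← sum_ramIdx_fibre hd c, Finset.card_eq_sum_ones, ← Finset.sum_add_distrib]
  exact Finset.sum_congr rfl fun t _ => Nat.sub_add_cancel (ramIdx_pos hd t)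

theorem disjoint_fibre (hd : 0 < degree φ) {c c' : OnePoint ℂ} (h : c ≠ c') :
    Disjoint (fibre φ c) (fibre φ c') := by
  rw [Finset.disjoint_left]
  intro t ht ht'
  exact h (((mem_fibre hd).1 ht).symm.trans ((mem_fibre hd).1 ht'))

/-- A covering with two further critical values has many points above three given points. -/
theorem degree_add_four_le (hd : 0 < degree φ) {a b c x y : OnePoint ℂ}
    (hnd : [a, b, c, x, y].Nodup) (hx : IsCriticalValue φ x) (hy : IsCriticalValue φ y) :
    degree φ + 4 ≤ (fibre φ a).card + (fibre φ b).card + (fibre φ c).card := by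
  classical
  obtain ⟨s, hs, hs'⟩ := hx
  obtain ⟨t, ht, ht'⟩ := hy
  simp only [List.nodup_cons, List.mem_cons, List.not_mem_nil, or_false, not_or] at hnd
  obtain ⟨⟨hab, hac, hax, hay⟩, ⟨hbc, hbx, hby⟩, ⟨hcx, hcy⟩, hxy, -⟩ := hnd
  have hst : s ≠ t := by
    rintro rfl
    exact hxy (hs.symm.trans ht)
  have hnot : ∀ {u v w : OnePoint ℂ}, map φ u = v → w ≠ v → u ∉ fibre φ w := by
    intro u v w h1 h2 h3
    exact h2 (((mem_fibre hd).1 h3).symm.trans h1)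
  have h := sum_ramIdx_sub_one_le hd
    (insert s (insert t (fibre φ a ∪ (fibre φ b ∪ fibre φ c))))
  -- With `N` points in the three fibres, Riemann–Hurwitz reads `(3d - N) + 1 + 1 + 2 ≤ 2d`.
  rw [Finset.sum_insert, Finset.sum_insert, Finset.sum_union, Finset.sum_union] at h
  · have h1 := sum_ramIdx_sub_one_add_card hd a
    have h2 := sum_ramIdx_sub_one_add_card hd b
    have h3 := sum_ramIdx_sub_one_add_card hd c
    omega
  · exact disjoint_fibre hd hbc
  · exact Finset.disjoint_union_right.2 ⟨disjoint_fibre hd hab, disjoint_fibre hd hac⟩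
  · simp [hnot ht hay, hnot ht hby, hnot ht hcy]
  · simp [hst, hnot hs hax, hnot hs hbx, hnot hs hcx]

theorem badFibre_subset_nonApparent (E : LinODE) (hd : 0 < degree φ) (c : OnePoint ℂ) :
    (badFibre φ c (E.orderAt c).toNat : Set (OnePoint ℂ)) ⊆
      (E.pullback (affine φ)).nonApparent := by
  intro t ht h
  obtain ⟨h1, h2⟩ := Finset.mem_filter.1 (Finset.mem_coe.1 ht)
  rw [mem_fibre hd] at h1
  refine h2 ?_
  rw [← h1]
  exact toNat_orderAt_dvd_ramIdx E hd h

theorem card_badFibre_le (E : LinODE) (hd : 0 < degree φ) {a b c : OnePoint ℂ}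
    (hab : a ≠ b) (hac : a ≠ c) (hbc : b ≠ c)
    (hfin : (E.pullback (affine φ)).nonApparent.Finite) :
    (badFibre φ a (E.orderAt a).toNat).card + (badFibre φ b (E.orderAt b).toNat).card +
      (badFibre φ c (E.orderAt c).toNat).card ≤ (E.pullback (affine φ)).nonApparent.ncard := by
  classical
  have hdis : ∀ {u v : OnePoint ℂ} {m n : ℕ}, u ≠ v →
      Disjoint (badFibre φ u m) (badFibre φ v n) := fun h =>
    Finset.disjoint_filter_filter (disjoint_fibre hd h)
  rw [add_assoc, ← Finset.card_union_of_disjoint (hdis hbc), ← Finset.card_union_of_disjoint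
    (Finset.disjoint_union_right.2 ⟨hdis hab, hdis hac⟩), ← Set.ncard_coe_finset]
  refine Set.ncard_le_ncard ?_ hfin
  rw [Finset.coe_union, Finset.coe_union]
  exact Set.union_subset (badFibre_subset_nonApparent E hd a)
    (Set.union_subset (badFibre_subset_nonApparent E hd b) (badFibre_subset_nonApparent E hd c))

end RatMap

/-! ### Arithmetic of the orders and the degree. -/

theorem recip_eq (P : ℕ∞) : recip P = 1 / (P.toNat : ℝ) := by
  cases P with
  | top =>
    change (0 : ℝ) = _
    simp
  | coe n => rfl

theorem floor_mul_recip (d : ℕ) (P : ℕ∞) :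
    ⌊(d : ℝ) * recip P⌋ = ((d / P.toNat : ℕ) : ℤ) := by
  rw [recip_eq, mul_one_div, ← Int.natCast_floor_eq_floor (by positivity), Nat.floor_div_eq_div]

theorem div_toNat_eq_zero {d : ℕ} {P : ℕ∞} (h : (d : ℕ∞) < P) : d / P.toNat = 0 := by
  cases P with
  | top => simp
  | coe n => exact Nat.div_eq_of_lt (by exact_mod_cast h)

theorem natDiv_le_mul_recip (d : ℕ) (P : ℕ∞) : ((d / P.toNat : ℕ) : ℝ) ≤ d * recip P := by
  rw [recip_eq, mul_one_div]
  exact Nat.cast_div_le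

theorem toNat_le_of_le {d : ℕ} {P : ℕ∞} (h : P ≤ d) : P.toNat ≤ d := by
  lift P to ℕ using ne_top_of_le_ne_top (ENat.natCast_ne_top d) h
  exact_mod_cast h

theorem toNat_pos_of_le {d : ℕ} {P : ℕ∞} (h1 : 1 ≤ P) (h : P ≤ d) : 1 ≤ P.toNat := by
  lift P to ℕ using ne_top_of_le_ne_top (ENat.natCast_ne_top d) h
  exact_mod_cast h1

/-- The remainder condition is needed: `(k, l, m) = (3, 3, 4)` with `d = 4` satisfies all the
others. -/
theorem one_div_add_one_div_ge {k l m d : ℕ} (hk : 1 ≤ k) (hkl : k ≤ l) (hlm : l ≤ m)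
    (hmd : m ≤ d) (hyp : (1 : ℝ) / k + 1 / l + 1 / m < 1) (hsum : d = d / k + d / l + d / m + 1)
    (hmod : 5 ≤ d % k + d % l + d % m) : (4 : ℝ) / 5 ≤ 1 / k + 1 / l := by
  by_contra! hlt
  have hd : (0 : ℝ) < d := by exact_mod_cast (by omega : 0 < d)
  have hm0 : (0 : ℝ) < m := by exact_mod_cast (by omega : 0 < m)
  -- If `m ≥ 10`, then `d < (4/5)d + d/10 + 1`, so `d < 10`, contradicting `m ≤ d`.
  have hm : m ≤ 9 := by
    by_contra! hm
    have h1 : ((d / k : ℕ) : ℝ) ≤ d * (1 / k) := by rw [mul_one_div]; exact Nat.cast_div_le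
    have h2 : ((d / l : ℕ) : ℝ) ≤ d * (1 / l) := by rw [mul_one_div]; exact Nat.cast_div_le
    have h3 : ((d / m : ℕ) : ℝ) ≤ d * (1 / 10) := by
      refine Nat.cast_div_le.trans ?_
      rw [mul_one_div]
      exact div_le_div_of_nonneg_left hd.le (by norm_num) (by exact_mod_cast hm)
    have h4 : (d : ℝ) = (d / k : ℕ) + (d / l : ℕ) + (d / m : ℕ) + 1 := by exact_mod_cast hsum
    have h5 : (d : ℝ) * (1 / k + 1 / l) < d * (4 / 5) := mul_lt_mul_of_pos_left hlt hd
    have h6 : (10 : ℝ) ≤ d := by exact_mod_cast (by omega : 10 ≤ d)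
    linarith
  have hk0 : (0 : ℝ) < k := by exact_mod_cast hk
  have hl0 : (0 : ℝ) < l := by exact_mod_cast (by omega : 0 < l)
  have hyp' : l * m + k * m + k * l < k * l * m := by
    have : ((l * m + k * m + k * l : ℕ) : ℝ) < (k * l * m : ℕ) := by
      push_cast
      field_simp at hyp
      linarith
    exact_mod_cast this
  have hlt' : 5 * (k + l) < 4 * (k * l) := by
    have : ((5 * (k + l) : ℕ) : ℝ) < (4 * (k * l) : ℕ) := by
      push_cast
      field_simp at hlt
      linarith
    exact_mod_cast this
  have hl : l ≤ 9 := by omega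
  have hk : k ≤ 9 := by omega
  clear hyp hlt hd hm0 hk0 hl0
  interval_cases k <;> interval_cases l <;> first | omega | (interval_cases m <;> omega)

end

theorem mainTheorem7
    (E : LinODE) (hE : E.IsHypergeometric)
    (p₀ p₁ pinf : ℕ∞)
    (hp₀ : E.orderAt ((0 : ℂ) : OnePoint ℂ) = p₀)
    (hp₁ : E.orderAt ((1 : ℂ) : OnePoint ℂ) = p₁)
    (hpinf : E.orderAt OnePoint.infty = pinf)
    (h01 : p₀ ≤ p₁) (h1inf : p₁ ≤ pinf)
    (hyperbolic : recip p₀ + recip p₁ + recip pinf < 1)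
    (φ : RatFunc ℂ) (d : ℕ) (hd : RatMap.degree φ = d)
    (hcrit : ∃ c₁ c₂ : ℂ, c₁ ≠ c₂ ∧ c₁ ≠ 0 ∧ c₁ ≠ 1 ∧ c₂ ≠ 0 ∧ c₂ ≠ 1 ∧
      RatMap.IsCriticalValue φ (c₁ : OnePoint ℂ) ∧ RatMap.IsCriticalValue φ (c₂ : OnePoint ℂ))
    (hfive : (E.pullback (RatMap.affine φ)).nonApparent.ncard = 5) :
    ((d : ℤ) - ⌊(d : ℝ) * recip p₀⌋ - ⌊(d : ℝ) * recip p₁⌋ - ⌊(d : ℝ) * recip pinf⌋ = 1) ∧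
    (p₀ ≤ (d : ℕ∞) → (d : ℕ∞) < p₁ → 1 ≤ recip p₀ + 1 / (d : ℝ)) ∧
    (p₁ ≤ (d : ℕ∞) → (d : ℕ∞) < pinf → 1 ≤ recip p₀ + recip p₁ + 1 / (d : ℝ)) ∧
    (pinf ≤ (d : ℕ∞) → 4 / 5 ≤ recip p₀ + recip p₁ ∧ recip p₀ + recip p₁ < 1) := by
  obtain ⟨c₁, c₂, hne, h10, h11, h20, h21, hc1, hc2⟩ := hcrit
  have hdeg : 0 < RatMap.degree φ := by
    obtain ⟨t, -, ht⟩ := hc1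
    have := RatMap.ramIdx_le_degree φ t
    omega
  have hfib := RatMap.degree_add_four_le hdeg (a := ((0 : ℂ) : OnePoint ℂ))
    (b := ((1 : ℂ) : OnePoint ℂ)) (c := OnePoint.infty)
    (by simp [hne, h10.symm, h11.symm, h20.symm, h21.symm]) hc1 hc2
  have hbad := RatMap.card_badFibre_le E hdeg (a := ((0 : ℂ) : OnePoint ℂ))
    (b := ((1 : ℂ) : OnePoint ℂ)) (c := OnePoint.infty) (by simp) (by simp) (by simp)
    (Set.finite_of_ncard_pos (by omega))
  rw [hfive, hp₀, hp₁, hpinf] at hbad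
  have e0 := RatMap.card_goodFibre_add_card_badFibre φ ((0 : ℂ) : OnePoint ℂ) p₀.toNat
  have e1 := RatMap.card_goodFibre_add_card_badFibre φ ((1 : ℂ) : OnePoint ℂ) p₁.toNat
  have e2 := RatMap.card_goodFibre_add_card_badFibre φ OnePoint.infty pinf.toNat
  have f0 := RatMap.card_goodFibre_le hdeg ((0 : ℂ) : OnePoint ℂ) p₀.toNat
  have f1 := RatMap.card_goodFibre_le hdeg ((1 : ℂ) : OnePoint ℂ) p₁.toNat
  have f2 := RatMap.card_goodFibre_le hdeg OnePoint.infty pinf.toNat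
  have g0 := RatMap.mul_card_goodFibre_add_card_badFibre_le hdeg ((0 : ℂ) : OnePoint ℂ) p₀.toNat
  have g1 := RatMap.mul_card_goodFibre_add_card_badFibre_le hdeg ((1 : ℂ) : OnePoint ℂ) p₁.toNat
  have g2 := RatMap.mul_card_goodFibre_add_card_badFibre_le hdeg OnePoint.infty pinf.toNat
  rw [hd] at hdeg hfib f0 f1 f2 g0 g1 g2
  have hdR : (0 : ℝ) < d := by exact_mod_cast hdeg
  have r0 := natDiv_le_mul_recip d p₀
  have r1 := natDiv_le_mul_recip d p₁
  have r2 := natDiv_le_mul_recip d pinf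
  have hlt : d / p₀.toNat + d / p₁.toNat + d / pinf.toNat < d := by
    have h := mul_lt_mul_of_pos_left hyperbolic hdR
    have : ((d / p₀.toNat + d / p₁.toNat + d / pinf.toNat : ℕ) : ℝ) < d := by
      push_cast [Nat.cast_add]
      linarith
    exact_mod_cast this
  -- `d + 4 ≤ good + bad ≤ (sum of floors) + 5`, against `hlt`.
  have hsum : d = d / p₀.toNat + d / p₁.toNat + d / pinf.toNat + 1 := by omega
  have hsumR : (d : ℝ) = (d / p₀.toNat : ℕ) + (d / p₁.toNat : ℕ) + (d / pinf.toNat : ℕ) + 1 := by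
    exact_mod_cast hsum
  have hone : (d : ℝ) * (1 / d) = 1 := mul_one_div_cancel hdR.ne'
  refine ⟨?_, fun _ h1 => ?_, fun _ h2 => ?_, fun h => ⟨?_, ?_⟩⟩
  · rw [floor_mul_recip, floor_mul_recip, floor_mul_recip]
    omega
  · rw [div_toNat_eq_zero h1, div_toNat_eq_zero (h1.trans_le h1inf), Nat.cast_zero] at hsumR
    refine le_of_mul_le_mul_left ?_ hdR
    linarith
  · rw [div_toNat_eq_zero h2, Nat.cast_zero] at hsumR
    refine le_of_mul_le_mul_left ?_ hdR
    linarith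
  · have q0 : 1 ≤ p₀ := hp₀ ▸ E.one_le_orderAt _
    have hm := ENat.toNat_le_toNat h1inf (ne_top_of_le_ne_top (ENat.natCast_ne_top d) h)
    have hl := ENat.toNat_le_toNat h01
      (ne_top_of_le_ne_top (ENat.natCast_ne_top d) (h1inf.trans h))
    rw [recip_eq, recip_eq]
    rw [recip_eq, recip_eq, recip_eq] at hyperbolic
    refine one_div_add_one_div_ge (toNat_pos_of_le q0 ((h01.trans h1inf).trans h)) hl hm
      (toNat_le_of_le h) hyperbolic hsum ?_
    -- By `hsum` the count has no slack: there are five bad points in all, and those above each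
    -- value number at most the remainder of `d`.
    have s0 : (RatMap.goodFibre φ ((0 : ℂ) : OnePoint ℂ) p₀.toNat).card = d / p₀.toNat := by omega
    have s1 : (RatMap.goodFibre φ ((1 : ℂ) : OnePoint ℂ) p₁.toNat).card = d / p₁.toNat := by omega
    have s2 : (RatMap.goodFibre φ OnePoint.infty pinf.toNat).card = d / pinf.toNat := by omega
    rw [s0] at g0
    rw [s1] at g1
    rw [s2] at g2
    have t0 := Nat.div_add_mod d p₀.toNat
    have t1 := Nat.div_add_mod d p₁.toNat
    have t2 := Nat.div_add_mod d pinf.toNat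
    omega
  · have hm : 0 < pinf.toNat := toNat_pos_of_le
      (hpinf ▸ E.one_le_orderAt _) h
    have : 0 < recip pinf := by
      rw [recip_eq]
      positivity
    linarith
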